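/- Let $r,d\ge 0$ be integers, let $M=(a_{ij})$ be a non-degenerate real $r\times r$ matrix, and consider the exponential system $$u^i_{xy}=\exp\Big(\sum_{j=1}^r a_{ij}u^j\Big),\qquad i=1,\dots,r .$$ Write $u^i_k=D_x^k u^i$. Let $\Omega\subseteq\mathbb R^{rd}$ be open and let $I=I(u^1_1,\dots,u^r_1,\dots,u^1_d,\dots,u^r_d)$ be a differentiable real function on $\Omega$ that is a $y$-integral of the system, i.e. its total $y$-derivative by virtue of the system vanishes: $$D_y(I)=\sum_{i=1}^r\sum_{k=1}^d D_x^{k-1}\Big(e^{\sum_j a_{ij}u^j}\Big)\frac{\partial I}{\partial u^i_k}=0$$ for all values of the variables $u^i=u^i_0$ and of the $u^i_k$, $k\geq 1$, with $(u^i_k)_{1\le k\le d}\in\Omega$, where $D_x=\sum_{i}\sum_{k\ge 0}u^i_{k+1}\,\partial/\partial u^i_k$. Then the same function is an $n$-integral of the semi-discrete system $$u^i_{n+1,x}-u^i_{n,x}=\exp\Big(\sum_{j<i}a_{ij}u^j_n+\frac{a_{ii}}2\,(u^i_n+u^i_{n+1})+\sum_{j>i}a_{ij}u^j_{n+1}\Big),\qquad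 i=1,\dots,r. \qquad (*)$$ In detail, for functions $u_n,u_{n+1}$ of $x$ that are $C^d$ near a point $x_0$ put $U_n=(u^i_{n,x},u^i_{n,xx},\dots,\partial_x^d u^i_n)_{i}$ and $U_{n+1}=(u^i_{n+1,x},\dots,\partial_x^d u^i_{n+1})_i$, taken at $x_0$. Then: (1) if $\Omega=\mathbb R^{rd}$, then $I(U_{n+1})-I(U_n)=0$ for all such $u_n,u_{n+1}$ satisfying $(*)$ near $x_0$; (2) for arbitrary open $\Omega$ the identity holds for small increments: for every $P\in\Omega$ there is $\varepsilon>0$ such that for all $x_0$ and all such $u_n,u_{n+1}$ satisfying $(*)$ near $x_0$ with $U_n=P$ and $u^i_{n+1,x}(x_0)-u^i_{n,x}(x_0)<\varepsilon$ for all $i$, one has $U_{n+1}\in\Omega$ and $I(U_{n+1})-I(U_n)=0$. -/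

import Mathlib

noncomputable section

namespace ExpSystem

/-- The infinite jet space of `r` functions of `x`:
the coordinate `p k i` is `u^i_k = D_x^k u^i`, `k = 0, 1, 2, …`. -/
abbrev Jet (r : ℕ) : Type := ℕ → Fin r → ℝ

/-- The space of the variables `u^i_1, …, u^i_d` (that is `u^i_x, u^i_xx, …`), without `u^i` itself:
the coordinate `P k i` is `u^i_{k+1}`. -/
abbrev DJet (d r : ℕ) : Type := Fin d → Fin r → ℝ

/-- The projection of a jet to its `x`-derivatives of orders `1, …, d`. -/
def toDJet {r : ℕ} (d : ℕ) (p : Jet r) : DJet d r := fun k i => p ((k : ℕ) + 1) i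

/-- The partial derivative `∂F/∂u^i_k` of a function on the jet space. -/
def partialJet {r : ℕ} (F : Jet r → ℝ) (k : ℕ) (i : Fin r) (p : Jet r) : ℝ :=
  deriv (fun s : ℝ => F (Function.update p k (Function.update (p k) i s))) (p k i)

/-- The total derivative `D_x F = ∑_{k,i} u^i_{k+1} ∂F/∂u^i_k`. For a function of finitely many
jet variables only finitely many terms are nonzero. -/
def totalDx {r : ℕ} (F : Jet r → ℝ) (p : Jet r) : ℝ :=
  ∑ᶠ q : ℕ × Fin r, p (q.1 + 1) q.2 * partialJet F q.1 q.2 p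

/-- The right-hand side `exp (∑_j a_{ij} u^j)` of the `i`-th equation of the exponential system,
as a function on the jet space. -/
def expRHS {r : ℕ} (a : Matrix (Fin r) (Fin r) ℝ) (i : Fin r) (p : Jet r) : ℝ :=
  Real.exp (∑ j, a i j * p 0 j)

/-- The partial derivative `∂I/∂u^i_{k+1}` of a function `I` of `u_1, …, u_d`. -/
def partialDJet {d r : ℕ} (I : DJet d r → ℝ) (k : Fin d) (i : Fin r) (P : DJet d r) : ℝ :=
  fderiv ℝ I P (Pi.single k (Pi.single i 1))

/-- The total `y`-derivative of `I(u_x, u_xx, …)` by virtue of `u^i_{xy} = exp (∑_j a_{ij} u^j)`: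
`D_y I = ∑_{i} ∑_{k = 1}^{d} D_x^{k-1}(exp (∑_j a_{ij} u^j)) ∂I/∂u^i_k`. -/
def totalDy {d r : ℕ} (a : Matrix (Fin r) (Fin r) ℝ) (I : DJet d r → ℝ) (p : Jet r) : ℝ :=
  ∑ i : Fin r, ∑ k : Fin d,
    (totalDx^[(k : ℕ)] (expRHS a i)) p * partialDJet I k i (toDJet d p)

/-- `I`, a function of `u_x, u_xx, …` on the domain `Ω`, is a `y`-integral of the exponential
system. -/
def IsYIntegralOn {d r : ℕ} (a : Matrix (Fin r) (Fin r) ℝ) (Ω : Set (DJet d r))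
    (I : DJet d r → ℝ) : Prop :=
  DifferentiableOn ℝ I Ω ∧ ∀ p : Jet r, toDJet d p ∈ Ω → totalDy a I p = 0

/-- The semi-discrete exponential system for the functions `u n i = u^i_n` of `x`,
at the step from `n` to `n + 1` and at the point `x`. -/
def SemiDiscreteEq {r : ℕ} (a : Matrix (Fin r) (Fin r) ℝ) (u : ℤ → Fin r → ℝ → ℝ) (n : ℤ)
    (x : ℝ) : Prop :=
  ∀ i : Fin r, deriv (u (n + 1) i) x - deriv (u n i) x =
    Real.exp (∑ j ∈ Finset.Iio i, a i j * u n j x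
      + a i i / 2 * (u n i x + u (n + 1) i x)
      + ∑ j ∈ Finset.Ioi i, a i j * u (n + 1) j x)

/-- `u_n` and `u_{n+1}` are of class `C^d` near `x₀` and satisfy the semi-discrete system there.
No other level of the chain is constrained. -/
def IsSemiDiscreteSolutionNear {r : ℕ} (a : Matrix (Fin r) (Fin r) ℝ) (d : ℕ)
    (u : ℤ → Fin r → ℝ → ℝ) (n : ℤ) (x₀ : ℝ) : Prop :=
  (∀ i, ContDiffAt ℝ d (u n i) x₀) ∧ (∀ i, ContDiffAt ℝ d (u (n + 1) i) x₀) ∧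
    ∀ᶠ x in nhds x₀, SemiDiscreteEq a u n x

/-- The values `u^i_{n,x}, u^i_{n,xx}, …` (up to order `d`) of a tuple of functions at `x`. -/
def derivJet {r : ℕ} (d : ℕ) (f : Fin r → ℝ → ℝ) (x : ℝ) : DJet d r :=
  fun k i => iteratedDeriv ((k : ℕ) + 1) (f i) x

/-- `I`, defined for all values of `u_x, u_xx, …`, is an `n`-integral of the semi-discrete system:
`I_{n+1} - I_n = 0` by virtue of the system. -/
def IsNIntegral {d r : ℕ} (a : Matrix (Fin r) (Fin r) ℝ) (I : DJet d r → ℝ) : Prop :=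
  ∀ (u : ℤ → Fin r → ℝ → ℝ) (n : ℤ) (x₀ : ℝ), IsSemiDiscreteSolutionNear a d u n x₀ →
    I (derivJet d (u (n + 1)) x₀) - I (derivJet d (u n) x₀) = 0

/-- The same for a function `I` on a domain `Ω`: the identity `I_{n+1} - I_n = 0` as an identity of
germs in the increments `u^i_{n+1,x} - u^i_{n,x}` at `0`. Every value `P ∈ Ω` of
`(u_{n,x}, u_{n,xx}, …)` has an `ε > 0`, the same for all solutions, such that `I_{n+1}` is defined
and equal to `I_n = I(P)` whenever the increments are less than `ε` (by the system they are
positive). -/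
def IsNIntegralOn {d r : ℕ} (a : Matrix (Fin r) (Fin r) ℝ) (Ω : Set (DJet d r))
    (I : DJet d r → ℝ) : Prop :=
  ∀ P ∈ Ω, ∃ ε > 0, ∀ (u : ℤ → Fin r → ℝ → ℝ) (n : ℤ) (x₀ : ℝ),
    IsSemiDiscreteSolutionNear a d u n x₀ → derivJet d (u n) x₀ = P →
    (∀ i, deriv (u (n + 1) i) x₀ - deriv (u n i) x₀ < ε) →
      derivJet d (u (n + 1)) x₀ ∈ Ω ∧
        I (derivJet d (u (n + 1)) x₀) - I (derivJet d (u n) x₀) = 0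

end ExpSystem

end

/-! The coefficients of the exponentials in `D_y I` involve only derivatives of order at least 1,
while the exponents `∑ j, a i j * u j` take arbitrary values because `a` is invertible. So `D_y I =
0` splits into `X_i I = 0` for each `i`, where `X_i = ∑_k B_{k-1} ∂/∂u^i_k` and the `B_k` are the
complete Bell polynomials in the derivatives of the `i`-th row
(`IsYIntegralOn.sum_bell_mul_partialDJet`).

The semi-discrete step moves along the `X_i`. Replace `u^i_n` by `u^i_{n+1}` one index at a time,
from the last downwards. With `g = u^i_{n+1,x} - u^i_{n,x}` and `w` the `x`-derivative of the `i`-th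
row before the replacement, the system gives `g' = g (w + a_ii / 2 * g)`. Hence `t = g(x₀)`
determines the needed derivatives of `g`, polynomially in `t`
(`IsSemiDiscreteSolutionNear.mixedJet_eq_step`). Differentiation in `t` doubles `a_ii / 2`, and the
result is the Bell polynomials in `w + a_ii * g`, the row after the replacement. So `t ↦ step a i t
P` is an integral curve of `X_i` through `P` at `t = 0` (`hasDerivAt_step`), and `I` is constant
along it inside `Ω`. If `Ω` is not the whole space, continuity keeps the curves inside it for small
increments. -/

noncomputable section

namespace ExpSystem

open Finset Filter Topology

/-! ### Bell polynomials and the equation `g' = g (w + b / 2 * g)` -/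

/-- The complete Bell polynomials in `w 0, w 1, …`: if `w m` is the derivative of order `m + 1` of
a function `f` at a point, then the derivative of order `k` of `exp f` is `exp f * bell w k`. -/
def bell (w : ℕ → ℝ) : ℕ → ℝ
  | 0 => 1
  | k + 1 => ∑ m : Fin (k + 1), (k.choose m : ℝ) * (bell w m * w (k - m))

/-- The derivatives `g, g', g'', …` at a point of the solution of `g' = g (w + b / 2 * g)` with
initial value `t`, where `w m` is the derivative of order `m` of the coefficient `w`. -/
def increment (b : ℝ) (w : ℕ → ℝ) (t : ℝ) : ℕ → ℝ
  | 0 => t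
  | k + 1 => ∑ m : Fin (k + 1), (k.choose m : ℝ) *
      (increment b w t m * (w (k - m) + b / 2 * increment b w t (k - m)))
decreasing_by all_goals omega

lemma bell_zero (w : ℕ → ℝ) : bell w 0 = 1 := by rw [bell]

lemma bell_succ (w : ℕ → ℝ) (k : ℕ) : bell w (k + 1) =
    ∑ q ∈ antidiagonal k, (k.choose q.1 : ℝ) * (bell w q.1 * w q.2) := by
  rw [bell, Nat.sum_antidiagonal_eq_sum_range_succ_mk, Finset.sum_range]

lemma increment_zero (b : ℝ) (w : ℕ → ℝ) (t : ℝ) : increment b w t 0 = t := by rw [increment]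

lemma increment_succ (b : ℝ) (w : ℕ → ℝ) (t : ℝ) (k : ℕ) : increment b w t (k + 1) =
    ∑ q ∈ antidiagonal k, (k.choose q.1 : ℝ) *
      (increment b w t q.1 * (w q.2 + b / 2 * increment b w t q.2)) := by
  rw [increment, Nat.sum_antidiagonal_eq_sum_range_succ_mk, Finset.sum_range]

/-- The recurrence is linear in `x` and determines it from `x 0`. It is assumed only below `n`, so
that data known to finite order suffice. -/
lemma eq_mul_bell_of_recurrence {w x : ℕ → ℝ} {n : ℕ}
    (h : ∀ k < n, x (k + 1) = ∑ q ∈ antidiagonal k, (k.choose q.1 : ℝ) * (x q.1 * w q.2)) :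
    ∀ k ≤ n, x k = x 0 * bell w k := by
  intro k
  induction k using Nat.strong_induction_on with
  | _ k ih =>
    intro hk
    cases k with
    | zero => rw [bell_zero, mul_one]
    | succ k =>
      rw [h k hk, bell_succ, Finset.mul_sum]
      refine Finset.sum_congr rfl fun q hq => ?_
      have hq' := mem_antidiagonal.1 hq
      rw [ih q.1 (by omega) (by omega)]
      ring

lemma bell_congr {v w : ℕ → ℝ} {n : ℕ} (h : ∀ m < n, v m = w m) : bell v n = bell w n := by
  have := eq_mul_bell_of_recurrence (x := bell v) (w := w) (n := n) (fun k hk => by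
    rw [bell_succ]
    refine Finset.sum_congr rfl fun q hq => ?_
    have hq' := mem_antidiagonal.1 hq
    rw [h q.2 (by omega)]) n le_rfl
  rwa [bell_zero, one_mul] at this

lemma eq_increment_of_recurrence {b t : ℝ} {w x : ℕ → ℝ} {n : ℕ} (h0 : x 0 = t)
    (h : ∀ k < n, x (k + 1) =
      ∑ q ∈ antidiagonal k, (k.choose q.1 : ℝ) * (x q.1 * (w q.2 + b / 2 * x q.2))) :
    ∀ k ≤ n, x k = increment b w t k := by
  intro k
  induction k using Nat.strong_induction_on with
  | _ k ih =>
    intro hk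
    cases k with
    | zero => rw [increment_zero, h0]
    | succ k =>
      rw [h k hk, increment_succ]
      refine Finset.sum_congr rfl fun q hq => ?_
      have hq' := mem_antidiagonal.1 hq
      rw [ih q.1 (by omega) (by omega), ih q.2 (by omega) (by omega)]

lemma increment_at_zero (b : ℝ) (w : ℕ → ℝ) (k : ℕ) : increment b w 0 k = 0 :=
  (eq_increment_of_recurrence (x := fun _ => 0) (n := k) rfl (fun k _ => by simp) k le_rfl).symm

lemma sum_antidiagonal_choose_comm (k : ℕ) (f g : ℕ → ℝ) :
    ∑ q ∈ antidiagonal k, (k.choose q.1 : ℝ) * (f q.1 * g q.2) =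
      ∑ q ∈ antidiagonal k, (k.choose q.1 : ℝ) * (g q.1 * f q.2) := by
  rw [← Nat.sum_antidiagonal_swap]
  refine Finset.sum_congr rfl fun q hq => ?_
  have hq' := mem_antidiagonal.1 hq
  rw [Prod.fst_swap, Prod.snd_swap, Nat.choose_symm_of_eq_add (n := k) (a := q.2) (b := q.1)
    (by omega)]
  ring

lemma differentiable_increment (b : ℝ) (w : ℕ → ℝ) (k : ℕ) :
    Differentiable ℝ fun t => increment b w t k := by
  induction k using Nat.strong_induction_on with
  | _ k ih =>
    cases k with
    | zero => simpa only [increment_zero] using differentiable_fun_id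
    | succ k =>
      simp only [increment_succ]
      refine Differentiable.fun_sum fun q hq => ?_
      have hq' := mem_antidiagonal.1 hq
      have h1 := ih q.1 (by omega)
      have h2 := ih q.2 (by omega)
      fun_prop

/-- The `t`-derivative of the quadratic recurrence is a linear one with initial value 1, hence
solved by Bell polynomials. -/
lemma hasDerivAt_increment (b : ℝ) (w : ℕ → ℝ) (t : ℝ) (k : ℕ) :
    HasDerivAt (fun t => increment b w t k)
      (bell (fun m => w m + b * increment b w t m) k) t := by
  set x : ℕ → ℝ := fun k => deriv (fun t => increment b w t k) t with hx
  have hd : ∀ k, HasDerivAt (fun t => increment b w t k) (x k) t := fun k =>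
    (differentiable_increment b w k t).hasDerivAt
  have h0 : x 0 = 1 := by simp [hx, increment_zero]
  have hrec : ∀ j < k, x (j + 1) = ∑ q ∈ antidiagonal j,
      (j.choose q.1 : ℝ) * (x q.1 * (w q.2 + b * increment b w t q.2)) := by
    intro j _
    have h1 : HasDerivAt (fun t => increment b w t (j + 1))
        (∑ q ∈ antidiagonal j, (j.choose q.1 : ℝ) *
          (x q.1 * (w q.2 + b / 2 * increment b w t q.2) +
            increment b w t q.1 * (b / 2 * x q.2))) t := by
      simp only [increment_succ]
      exact HasDerivAt.fun_sum fun q _ =>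
        ((hd q.1).mul (((hd q.2).const_mul (b / 2)).const_add (w q.2))).const_mul _
    rw [(hd (j + 1)).unique h1]
    -- By the symmetry of the binomial sum, differentiating the second factor contributes another `b
    -- / 2`; this is why `b / 2` becomes `b`.
    have h2 := sum_antidiagonal_choose_comm j (fun m => b / 2 * increment b w t m) x
    calc _ = ∑ q ∈ antidiagonal j, (j.choose q.1 : ℝ) *
              (x q.1 * (w q.2 + b / 2 * increment b w t q.2)) +
            ∑ q ∈ antidiagonal j, (j.choose q.1 : ℝ) *
              (b / 2 * increment b w t q.1 * x q.2) := by
          rw [← Finset.sum_add_distrib]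
          exact Finset.sum_congr rfl fun q _ => by ring
      _ = _ := by
          rw [h2, ← Finset.sum_add_distrib]
          exact Finset.sum_congr rfl fun q _ => by ring
  have := eq_mul_bell_of_recurrence (w := fun m => w m + b * increment b w t m) hrec k le_rfl
  rw [h0, one_mul] at this
  exact this ▸ hd k

lemma continuous_increment {X : Type*} [TopologicalSpace X] (b : ℝ) {w : X → ℕ → ℝ} {t : X → ℝ}
    (hw : ∀ m, Continuous fun x => w x m) (ht : Continuous t) (k : ℕ) :
    Continuous fun x => increment b (w x) (t x) k := by
  induction k using Nat.strong_induction_on with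
  | _ k ih =>
    cases k with
    | zero => simpa only [increment_zero] using ht
    | succ k =>
      simp only [increment_succ]
      refine continuous_finsetSum _ fun q hq => ?_
      have hq' := mem_antidiagonal.1 hq
      have h1 := ih q.1 (by omega)
      have h2 := ih q.2 (by omega)
      have h3 := hw q.2
      fun_prop

/-! ### The total derivative `D_x` as a derivation, and its iterates on the exponentials -/

variable {d r : ℕ}

/-- Functions of finitely many jet variables that have all partial derivatives. -/
structure JetDifferentiable (F : Jet r → ℝ) : Prop where
  differentiableAt : ∀ p k i, DifferentiableAt ℝ
    (fun s : ℝ => F (Function.update p k (Function.update (p k) i s))) (p k i)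
  partialJet_eq_zero : ∃ N, ∀ p k i, N ≤ k → partialJet F k i p = 0

lemma JetDifferentiable.hasFiniteSupport {F : Jet r → ℝ} (hF : JetDifferentiable F) (p : Jet r) :
    (fun q : ℕ × Fin r => p (q.1 + 1) q.2 * partialJet F q.1 q.2 p).HasFiniteSupport := by
  obtain ⟨N, hN⟩ := hF.partialJet_eq_zero
  refine ((Set.finite_Iio N).prod (Set.finite_univ (α := Fin r))).subset fun q hq => ?_
  refine ⟨?_, Set.mem_univ _⟩
  by_contra h
  exact hq (by simp only [hN p q.1 q.2 (not_lt.1 h), mul_zero])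

lemma partialJet_add {F G : Jet r → ℝ} (hF : JetDifferentiable F) (hG : JetDifferentiable G)
    (k : ℕ) (i : Fin r) (p : Jet r) :
    partialJet (fun p => F p + G p) k i p = partialJet F k i p + partialJet G k i p :=
  deriv_fun_add (hF.differentiableAt p k i) (hG.differentiableAt p k i)

lemma partialJet_mul {F G : Jet r → ℝ} (hF : JetDifferentiable F) (hG : JetDifferentiable G)
    (k : ℕ) (i : Fin r) (p : Jet r) :
    partialJet (fun p => F p * G p) k i p =
      G p * partialJet F k i p + F p * partialJet G k i p := by
  have := deriv_fun_mul (hF.differentiableAt p k i) (hG.differentiableAt p k i)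
  simp only [Function.update_eq_self] at this
  rw [partialJet, this, partialJet, partialJet]
  ring

lemma partialJet_exp {F : Jet r → ℝ} (hF : JetDifferentiable F) (k : ℕ) (i : Fin r) (p : Jet r) :
    partialJet (fun p => Real.exp (F p)) k i p = Real.exp (F p) * partialJet F k i p := by
  have := deriv_exp (hF.differentiableAt p k i)
  simp only [Function.update_eq_self] at this
  exact this

lemma jetDifferentiable_const (c : ℝ) : JetDifferentiable fun _ : Jet r => c :=
  ⟨fun _ _ _ => differentiableAt_const _, 0, fun _ _ _ _ => by simp [partialJet]⟩

lemma JetDifferentiable.add {F G : Jet r → ℝ} (hF : JetDifferentiable F)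
    (hG : JetDifferentiable G) : JetDifferentiable fun p => F p + G p := by
  refine ⟨fun p k i => (hF.differentiableAt p k i).add (hG.differentiableAt p k i), ?_⟩
  obtain ⟨M, hM⟩ := hF.partialJet_eq_zero
  obtain ⟨N, hN⟩ := hG.partialJet_eq_zero
  refine ⟨max M N, fun p k i hk => ?_⟩
  rw [partialJet_add hF hG, hM p k i (le_of_max_le_left hk), hN p k i (le_of_max_le_right hk),
    add_zero]

lemma JetDifferentiable.mul {F G : Jet r → ℝ} (hF : JetDifferentiable F)
    (hG : JetDifferentiable G) : JetDifferentiable fun p => F p * G p := by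
  refine ⟨fun p k i => (hF.differentiableAt p k i).mul (hG.differentiableAt p k i), ?_⟩
  obtain ⟨M, hM⟩ := hF.partialJet_eq_zero
  obtain ⟨N, hN⟩ := hG.partialJet_eq_zero
  refine ⟨max M N, fun p k i hk => ?_⟩
  rw [partialJet_mul hF hG, hM p k i (le_of_max_le_left hk), hN p k i (le_of_max_le_right hk),
    mul_zero, mul_zero, add_zero]

lemma JetDifferentiable.exp {F : Jet r → ℝ} (hF : JetDifferentiable F) :
    JetDifferentiable fun p => Real.exp (F p) := by
  refine ⟨fun p k i => (hF.differentiableAt p k i).exp, ?_⟩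
  obtain ⟨N, hN⟩ := hF.partialJet_eq_zero
  exact ⟨N, fun p k i hk => by rw [partialJet_exp hF, hN p k i hk, mul_zero]⟩

lemma JetDifferentiable.sum {ι : Type*} {s : Finset ι} {F : ι → Jet r → ℝ}
    (hF : ∀ l ∈ s, JetDifferentiable (F l)) : JetDifferentiable fun p => ∑ l ∈ s, F l p := by
  classical
  induction s using Finset.induction_on with
  | empty => simpa using jetDifferentiable_const 0
  | insert l s hl ih =>
    simp only [Finset.sum_insert hl]
    exact (hF l (mem_insert_self l s)).add (ih fun m hm => hF m (mem_insert_of_mem hm))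

lemma totalDx_const (c : ℝ) : totalDx (fun _ : Jet r => c) = fun _ => 0 := by
  funext p
  simp [totalDx, partialJet]

lemma totalDx_add {F G : Jet r → ℝ} (hF : JetDifferentiable F) (hG : JetDifferentiable G) :
    totalDx (fun p => F p + G p) = fun p => totalDx F p + totalDx G p := by
  funext p
  simp only [totalDx, partialJet_add hF hG, mul_add]
  exact finsum_add_distrib (hF.hasFiniteSupport p) (hG.hasFiniteSupport p)

lemma totalDx_mul {F G : Jet r → ℝ} (hF : JetDifferentiable F) (hG : JetDifferentiable G) :
    totalDx (fun p => F p * G p) = fun p => totalDx F p * G p + F p * totalDx G p := by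
  funext p
  rw [mul_comm (totalDx F p)]
  simp only [totalDx, partialJet_mul hF hG, mul_add]
  rw [mul_finsum, mul_finsum, ← finsum_add_distrib]
  · exact finsum_congr fun q => by ring
  · exact (hF.hasFiniteSupport p).subset fun q hq h => hq (by simp only [h, mul_zero])
  · exact (hG.hasFiniteSupport p).subset fun q hq h => hq (by simp only [h, mul_zero])

lemma totalDx_exp {F : Jet r → ℝ} (hF : JetDifferentiable F) :
    totalDx (fun p => Real.exp (F p)) = fun p => Real.exp (F p) * totalDx F p := by
  funext p
  simp only [totalDx, partialJet_exp hF, mul_finsum]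
  exact finsum_congr fun q => by ring

lemma totalDx_sum {ι : Type*} {s : Finset ι} {F : ι → Jet r → ℝ}
    (hF : ∀ l ∈ s, JetDifferentiable (F l)) :
    totalDx (fun p => ∑ l ∈ s, F l p) = fun p => ∑ l ∈ s, totalDx (F l) p := by
  classical
  induction s using Finset.induction_on with
  | empty => simpa using totalDx_const 0
  | insert l s hl ih =>
    have h := fun m hm => hF m (mem_insert_of_mem hm)
    simp only [Finset.sum_insert hl]
    rw [totalDx_add (hF l (mem_insert_self l s)) (JetDifferentiable.sum h), ih h]

lemma hasDerivAt_linear (c : Fin r → ℝ) (m : ℕ) (p : Jet r) (k : ℕ) (i : Fin r) :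
    HasDerivAt (fun s : ℝ => ∑ j, c j * Function.update p k (Function.update (p k) i s) m j)
      (if k = m then c i else 0) (p k i) := by
  by_cases h : k = m
  · subst h
    simp only [Function.update_self, if_true]
    have : HasDerivAt (fun s : ℝ => ∑ j, c j * Function.update (p k) i s j)
        (∑ j, c j * (Pi.single i (1 : ℝ) : Fin r → ℝ) j) (p k i) :=
      HasDerivAt.fun_sum fun j _ =>
        ((hasDerivAt_pi.1 (hasDerivAt_update (p k) i (p k i))) j).const_mul (c j)
    simpa [Pi.single_apply] using this
  · simp only [Function.update_of_ne (Ne.symm h), if_neg h]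
    exact hasDerivAt_const _ _

lemma jetDifferentiable_linear (c : Fin r → ℝ) (m : ℕ) :
    JetDifferentiable fun p : Jet r => ∑ j, c j * p m j :=
  ⟨fun p k i => (hasDerivAt_linear c m p k i).differentiableAt, m + 1, fun p k i hk => by
    rw [partialJet, (hasDerivAt_linear c m p k i).deriv, if_neg (by omega)]⟩

lemma totalDx_linear (c : Fin r → ℝ) (m : ℕ) :
    totalDx (fun p : Jet r => ∑ j, c j * p m j) = fun p => ∑ j, c j * p (m + 1) j := by
  funext p
  have h : ∀ q : ℕ × Fin r, p (q.1 + 1) q.2 *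
      partialJet (fun p : Jet r => ∑ j, c j * p m j) q.1 q.2 p =
        p (q.1 + 1) q.2 * if q.1 = m then c q.2 else 0 := fun q => by
    rw [partialJet, (hasDerivAt_linear c m p q.1 q.2).deriv]
  rw [totalDx, finsum_congr h,
    finsum_eq_sum_of_support_subset (s := ({m} : Finset ℕ) ×ˢ (Finset.univ : Finset (Fin r)))]
  · rw [Finset.sum_product, Finset.sum_singleton]
    exact Finset.sum_congr rfl fun j _ => by rw [if_pos rfl, mul_comm]
  · intro q hq
    by_contra hm
    refine hq ?_
    have : q.1 ≠ m := fun h => hm (Finset.mem_coe.2 (Finset.mem_product.2 ⟨by simp [h], Finset.mem_univ _⟩))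
    simp [this]

/-- Iterated Leibniz rule for `D_x E = E * D_x (log E)`. The two claims are proved together: the
product rule needs differentiability of the lower iterates, which is read off from their formula. -/
lemma totalDx_iterate_expRHS_recurrence (a : Matrix (Fin r) (Fin r) ℝ) (i : Fin r) (k : ℕ) :
    JetDifferentiable (totalDx^[k] (expRHS a i)) ∧
    totalDx^[k + 1] (expRHS a i) = fun p => ∑ q ∈ antidiagonal k, (k.choose q.1 : ℝ) *
      ((totalDx^[q.1] (expRHS a i)) p * ∑ j, a i j * p (q.2 + 1) j) := by
  have hE : JetDifferentiable (expRHS a i) := (jetDifferentiable_linear (a i) 0).exp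
  induction k using Nat.strong_induction_on with
  | _ k ih =>
    cases k with
    | zero =>
      refine ⟨hE, ?_⟩
      have := totalDx_exp (jetDifferentiable_linear (a i) 0)
      rw [totalDx_linear] at this
      change totalDx (expRHS a i) = fun p => expRHS a i p * ∑ j, a i j * p (0 + 1) j at this
      simpa using this
    | succ k =>
      have hd : ∀ q ∈ antidiagonal k, JetDifferentiable fun p => (k.choose q.1 : ℝ) *
          ((totalDx^[q.1] (expRHS a i)) p * ∑ j, a i j * p (q.2 + 1) j) := fun q hq => by
        have hq' := mem_antidiagonal.1 hq
        exact (jetDifferentiable_const _).mul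
          ((ih q.1 (by omega)).1.mul (jetDifferentiable_linear (a i) (q.2 + 1)))
      have hk := (ih k (by omega)).2
      refine ⟨hk ▸ JetDifferentiable.sum hd, ?_⟩
      rw [Function.iterate_succ_apply', hk, totalDx_sum hd]
      funext p
      rw [sum_antidiagonal_choose_succ_mul
        (fun m n => (totalDx^[m] (expRHS a i)) p * ∑ j, a i j * p (n + 1) j) k,
        ← Finset.sum_add_distrib]
      refine Finset.sum_congr rfl fun q hq => ?_
      have hq' := mem_antidiagonal.1 hq
      have h1 := (ih q.1 (by omega)).1
      rw [totalDx_mul (jetDifferentiable_const _) (h1.mul (jetDifferentiable_linear (a i) _)),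
        totalDx_const, totalDx_mul h1 (jetDifferentiable_linear (a i) _), totalDx_linear,
        ← Function.iterate_succ_apply' totalDx,
        Nat.choose_symm_of_eq_add (n := k) (a := q.2) (b := q.1) (by omega)]
      ring

lemma totalDx_iterate_expRHS (a : Matrix (Fin r) (Fin r) ℝ) (i : Fin r) (k : ℕ) (p : Jet r) :
    (totalDx^[k] (expRHS a i)) p =
      expRHS a i p * bell (fun m => ∑ j, a i j * p (m + 1) j) k :=
  eq_mul_bell_of_recurrence (x := fun k => (totalDx^[k] (expRHS a i)) p)
    (fun k _ => congrFun (totalDx_iterate_expRHS_recurrence a i k).2 p) k le_rfl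

/-! ### Splitting `D_y I = 0` into separate equations -/

/-- The derivatives of orders `1, …, d` of `∑ j, a i j * u j`, continued by zero. -/
def rowJet (a : Matrix (Fin r) (Fin r) ℝ) (i : Fin r) (P : DJet d r) (m : ℕ) : ℝ :=
  if h : m < d then ∑ j, a i j * P ⟨m, h⟩ j else 0

lemma rowJet_of_lt (a : Matrix (Fin r) (Fin r) ℝ) (i : Fin r) (P : DJet d r) (k : Fin d) :
    rowJet a i P k = ∑ j, a i j * P k j := dif_pos k.2

lemma continuous_rowJet (a : Matrix (Fin r) (Fin r) ℝ) (i : Fin r) (m : ℕ) :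
    Continuous fun P : DJet d r => rowJet a i P m := by
  unfold rowJet
  split_ifs <;> fun_prop

/-- The coefficients of the separate exponentials in `D_y I = 0` vanish, since `a` is
non-degenerate. -/
lemma IsYIntegralOn.sum_bell_mul_partialDJet {a : Matrix (Fin r) (Fin r) ℝ} (ha : a.det ≠ 0)
    {Ω : Set (DJet d r)} {I : DJet d r → ℝ} (hI : IsYIntegralOn a Ω I) {P : DJet d r}
    (hP : P ∈ Ω) (i : Fin r) : ∑ k : Fin d, bell (rowJet a i P) k * partialDJet I k i P = 0 := by
  set c : Fin r → ℝ := fun i => ∑ k : Fin d, bell (rowJet a i P) k * partialDJet I k i P with hc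
  have key : ∀ w : Fin r → ℝ, ∑ i, Real.exp (w i) * c i = 0 := by
    intro w
    -- The order-zero variables are chosen to make the exponents equal to `w`; the orders `1, …, d`
    -- are those of `P`, and higher ones do not matter.
    let p : Jet r := fun
      | 0 => a⁻¹.mulVec w
      | k + 1 => if h : k < d then P ⟨k, h⟩ else 0
    have hp : toDJet d p = P := by
      funext k i
      simp [toDJet, p]
    have hrow : ∀ i m, m < d → ∑ j, a i j * p (m + 1) j = rowJet a i P m := fun i m hm => by
      simp [rowJet, p, hm]
    have hexp : ∀ i, expRHS a i p = Real.exp (w i) := fun i => by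
      have : a.mulVec (a⁻¹.mulVec w) = w := by
        rw [Matrix.mulVec_mulVec, Matrix.mul_nonsing_inv a (isUnit_iff_ne_zero.2 ha),
          Matrix.one_mulVec]
      exact congrArg Real.exp (congrFun this i)
    have h := hI.2 p (hp.symm ▸ hP)
    rw [totalDy, hp] at h
    rw [← h]
    refine Finset.sum_congr rfl fun i _ => ?_
    rw [hc, Finset.mul_sum]
    refine Finset.sum_congr rfl fun k _ => ?_
    rw [totalDx_iterate_expRHS, hexp,
      bell_congr (fun m hm => hrow i m (hm.trans k.2)), mul_assoc]
  -- Passing from `w = 0` to `w = log 2` in the single slot `i` changes the sum by `(2 - 1) * c i`.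
  have h0 := key 0
  have h1 := key (Pi.single i (Real.log 2))
  have h2 : ∑ j, (Real.exp ((Pi.single i (Real.log 2) : Fin r → ℝ) j) * c j -
      Real.exp ((0 : Fin r → ℝ) j) * c j) = c i := by
    rw [Finset.sum_eq_single i]
    · simp only [Pi.single_eq_same, Pi.zero_apply, Real.exp_zero,
        Real.exp_log (zero_lt_two' ℝ)]
      ring
    · intro j _ hj
      simp [Pi.single_eq_of_ne hj]
    · simp
  rw [Finset.sum_sub_distrib, h0, h1, sub_zero] at h2
  exact h2.symm

/-! ### The change of one function as motion along a vector field -/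

/-- The step of the semi-discrete system that changes only the `i`-th function,
its first derivative by `t`. -/
def step (a : Matrix (Fin r) (Fin r) ℝ) (i : Fin r) (t : ℝ) (P : DJet d r) : DJet d r :=
  fun k j => if j = i then P k j + increment (a i i) (rowJet a i P) t k else P k j

lemma step_zero (a : Matrix (Fin r) (Fin r) ℝ) (i : Fin r) (P : DJet d r) : step a i 0 P = P := by
  funext k j
  simp [step, increment_at_zero]

lemma rowJet_step (a : Matrix (Fin r) (Fin r) ℝ) (i : Fin r) (t : ℝ) (P : DJet d r) {m : ℕ}
    (hm : m < d) : rowJet a i (step a i t P) m =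
      rowJet a i P m + a i i * increment (a i i) (rowJet a i P) t m := by
  lift m to Fin d using hm
  rw [rowJet_of_lt, rowJet_of_lt]
  have : ∀ j, a i j * step a i t P m j = a i j * P m j +
      if j = i then a i i * increment (a i i) (rowJet a i P) t m else 0 := fun j => by
    by_cases h : j = i
    · subst h
      simp only [step, if_true]
      ring
    · simp [step, h]
  simp only [this, Finset.sum_add_distrib, Finset.sum_ite_eq', Finset.mem_univ, if_true]

/-- The velocity depends only on the current point: this is an integral curve of the field that
annihilates `I`. -/
lemma hasDerivAt_step (a : Matrix (Fin r) (Fin r) ℝ) (i : Fin r) (t : ℝ) (P : DJet d r) :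
    HasDerivAt (fun t => step a i t P)
      (∑ k : Fin d, bell (rowJet a i (step a i t P)) k •
        (Pi.single k (Pi.single i 1) : DJet d r)) t := by
  refine hasDerivAt_pi.2 fun k => hasDerivAt_pi.2 fun j => ?_
  have hsum : (∑ k : Fin d, bell (rowJet a i (step a i t P)) k •
      (Pi.single k (Pi.single i 1) : DJet d r)) k j =
        if j = i then bell (rowJet a i (step a i t P)) k else 0 := by
    rw [Finset.sum_apply, Finset.sum_apply, Finset.sum_eq_single k]
    · simp [Pi.single_apply]
    · intro l _ hl
      simp [Pi.single_eq_of_ne (Ne.symm hl)]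
    · simp
  -- `bell _ k` uses only indices `m < k < d`, where the cut-off of `rowJet` at `d` plays no role.
  rw [hsum, bell_congr (fun m hm => rowJet_step a i t P (hm.trans k.2))]
  by_cases h : j = i
  · simp only [step, if_pos h]
    exact (hasDerivAt_increment _ _ t k).const_add _
  · simp only [step, if_neg h]
    exact hasDerivAt_const _ _

lemma continuous_step (a : Matrix (Fin r) (Fin r) ℝ) (i : Fin r) :
    Continuous fun x : DJet d r × ℝ => step a i x.2 x.1 := by
  refine continuous_pi fun k => continuous_pi fun j => ?_
  have h : Continuous fun x : DJet d r × ℝ => increment (a i i) (rowJet a i x.1) x.2 k :=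
    continuous_increment _ (fun m => (continuous_rowJet a i m).comp continuous_fst)
      continuous_snd k
  unfold step
  split_ifs <;> fun_prop

/-- A `y`-integral is constant along every piece of the curve `t ↦ step a i t P` inside `Ω`. -/
lemma IsYIntegralOn.apply_step_eq {a : Matrix (Fin r) (Fin r) ℝ} (ha : a.det ≠ 0)
    {Ω : Set (DJet d r)} (hΩ : IsOpen Ω) {I : DJet d r → ℝ} (hI : IsYIntegralOn a Ω I)
    {i : Fin r} {P : DJet d r} {s : Set ℝ} (hs : IsOpen s) (hsc : IsPreconnected s)
    (h0 : 0 ∈ s) (hsΩ : ∀ t ∈ s, step a i t P ∈ Ω) {t : ℝ} (ht : t ∈ s) :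
    I (step a i t P) = I P := by
  have hd : ∀ t ∈ s, HasDerivAt (fun t => I (step a i t P)) 0 t := by
    intro t ht
    have hmem := hsΩ t ht
    have h := ((hI.1.differentiableAt (hΩ.mem_nhds hmem)).hasFDerivAt).comp_hasDerivAt t
      (hasDerivAt_step a i t P)
    simp only [map_sum, map_smul, smul_eq_mul] at h
    have hz := hI.sum_bell_mul_partialDJet ha hmem i
    simp only [partialDJet] at hz
    rw [hz] at h
    exact h
  have := hs.is_const_of_deriv_eq_zero hsc
    (fun t ht => (hd t ht).differentiableAt.differentiableWithinAt)
    (fun t ht => (hd t ht).deriv) ht h0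
  simpa only [step_zero] using this

/-- The base point varies too, since each step of a sweep starts where the previous one ended. -/
lemma IsYIntegralOn.eventually_step {a : Matrix (Fin r) (Fin r) ℝ} (ha : a.det ≠ 0)
    {Ω : Set (DJet d r)} (hΩ : IsOpen Ω) {I : DJet d r → ℝ} (hI : IsYIntegralOn a Ω I)
    (i : Fin r) {P : DJet d r} (hP : P ∈ Ω) :
    ∀ᶠ x : DJet d r × ℝ in 𝓝 (P, 0), step a i x.2 x.1 ∈ Ω ∧ I (step a i x.2 x.1) = I x.1 := by
  have h : ∀ᶠ x : DJet d r × ℝ in 𝓝 (P, 0), step a i x.2 x.1 ∈ Ω :=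
    (continuous_step a i).continuousAt.eventually_mem
      (hΩ.mem_nhds (by simpa only [step_zero] using hP))
  obtain ⟨ε, hε, hball⟩ := Metric.eventually_nhds_iff_ball.1 h
  refine Metric.eventually_nhds_iff_ball.2 ⟨ε, hε, fun x hx => ⟨hball x hx, ?_⟩⟩
  -- In the sup metric a ball is a product, so the whole curve for `|t| < ε` stays in `Ω`.
  rw [← ball_prod_same, Set.mem_prod] at hx
  exact hI.apply_step_eq ha hΩ Metric.isOpen_ball (convex_ball (0 : ℝ) ε).isPreconnected
    (Metric.mem_ball_self hε)
    (fun t ht => hball (x.1, t) (by rw [← ball_prod_same]; exact ⟨hx.1, ht⟩)) hx.2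

/-! ### Composition of the steps for all functions -/

/-- The result of the steps for the last `m` functions, from the last one downwards. -/
def sweep (a : Matrix (Fin r) (Fin r) ℝ) (δ : Fin r → ℝ) (P : DJet d r) : ℕ → DJet d r
  | 0 => P
  | m + 1 => if h : m < r then step a (Fin.rev ⟨m, h⟩) (δ (Fin.rev ⟨m, h⟩)) (sweep a δ P m)
      else sweep a δ P m

lemma continuous_sweep (a : Matrix (Fin r) (Fin r) ℝ) (m : ℕ) :
    Continuous fun x : DJet d r × (Fin r → ℝ) => sweep a x.2 x.1 m := by
  induction m with
  | zero => exact continuous_fst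
  | succ m ih =>
    simp only [sweep]
    split_ifs with h
    · exact (continuous_step a (Fin.rev ⟨m, h⟩)).comp
        (ih.prodMk ((continuous_apply (Fin.rev ⟨m, h⟩)).comp continuous_snd))
    · exact ih

lemma sweep_zero (a : Matrix (Fin r) (Fin r) ℝ) (P : DJet d r) (m : ℕ) :
    sweep a 0 P m = P := by
  induction m with
  | zero => rfl
  | succ m ih => simp [sweep, ih, step_zero]

lemma IsYIntegralOn.eventually_sweep {a : Matrix (Fin r) (Fin r) ℝ} (ha : a.det ≠ 0)
    {Ω : Set (DJet d r)} (hΩ : IsOpen Ω) {I : DJet d r → ℝ} (hI : IsYIntegralOn a Ω I)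
    {P : DJet d r} (hP : P ∈ Ω) (m : ℕ) :
    ∀ᶠ x : DJet d r × (Fin r → ℝ) in 𝓝 (P, 0),
      sweep a x.2 x.1 m ∈ Ω ∧ I (sweep a x.2 x.1 m) = I x.1 := by
  induction m with
  | zero =>
    exact (continuous_fst.continuousAt.eventually_mem (hΩ.mem_nhds hP)).mono fun x hx => ⟨hx, rfl⟩
  | succ m ih =>
    by_cases h : m < r
    -- With zero increments a sweep fixes `P`, so small increments keep the intermediate point near
    -- `P`.
    · have hlim : Tendsto
          (fun x : DJet d r × (Fin r → ℝ) => (sweep a x.2 x.1 m, x.2 (Fin.rev ⟨m, h⟩)))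
          (𝓝 (P, 0)) (𝓝 (P, 0)) := by
        have := ((continuous_sweep (d := d) a m).prodMk
          ((continuous_apply (Fin.rev ⟨m, h⟩)).comp continuous_snd)).tendsto
            (P, (0 : Fin r → ℝ))
        simpa only [sweep_zero, Function.comp_apply, Pi.zero_apply] using this
      filter_upwards [ih, hlim.eventually (hI.eventually_step ha hΩ (Fin.rev ⟨m, h⟩) hP)]
        with x hx hx'
      simp only [sweep, dif_pos h]
      exact ⟨hx'.1, hx'.2.trans hx.2⟩
    · simpa only [sweep, dif_neg h] using ih

lemma IsYIntegralOn.apply_sweep_eq {a : Matrix (Fin r) (Fin r) ℝ} (ha : a.det ≠ 0)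
    {I : DJet d r → ℝ} (hI : IsYIntegralOn a Set.univ I) (δ : Fin r → ℝ) (P : DJet d r) (m : ℕ) :
    I (sweep a δ P m) = I P := by
  induction m with
  | zero => rfl
  | succ m ih =>
    simp only [sweep]
    split_ifs with h
    · rw [hI.apply_step_eq ha isOpen_univ isOpen_univ isPreconnected_univ (Set.mem_univ _)
        (fun _ _ => Set.mem_univ _) (Set.mem_univ _), ih]
    · exact ih

/-! ### Solutions of the semi-discrete system as sweeps -/

/-- Leibniz rule for `g' = g * f'`; `k < d` leaves enough smoothness to differentiate it `k` times.
-/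
lemma iteratedDeriv_exp_recurrence {f g : ℝ → ℝ} {x₀ : ℝ} (hf : ContDiffAt ℝ d f x₀)
    (hg : g =ᶠ[𝓝 x₀] fun x => Real.exp (f x)) {k : ℕ} (hk : k < d) :
    iteratedDeriv (k + 1) g x₀ = ∑ q ∈ antidiagonal k, (k.choose q.1 : ℝ) *
      (iteratedDeriv q.1 g x₀ * iteratedDeriv (q.2 + 1) f x₀) := by
  have hd1 : ((1 : ℕ) : WithTop ℕ∞) ≤ d := by exact_mod_cast (by omega : 1 ≤ d)
  have hkd : (k : WithTop ℕ∞) + 1 ≤ d := by exact_mod_cast hk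
  have hderiv : deriv g =ᶠ[𝓝 x₀] fun x => g x * deriv f x := by
    have h1 : ∀ᶠ x in 𝓝 x₀, ContDiffAt ℝ (1 : ℕ) f x :=
      (hf.of_le hd1).eventually (by simp)
    filter_upwards [hg.deriv, hg, h1] with x hx hx' hfx
    rw [hx, hx', deriv_exp (hfx.differentiableAt (by simp))]
  have hgc : ContDiffAt ℝ k g x₀ :=
    ((hf.of_le (le_self_add.trans hkd)).exp).congr_of_eventuallyEq hg
  rw [iteratedDeriv_succ', hderiv.iteratedDeriv_eq k,
    iteratedDeriv_fun_mul hgc (hf.derivWithin hkd),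
    Nat.sum_antidiagonal_eq_sum_range_succ_mk]
  refine Finset.sum_congr rfl fun m _ => ?_
  rw [iteratedDeriv_succ', mul_assoc]

/-- The jet whose components with index `≥ m` are those of `Q`, the other ones those of `P`. -/
def mixedJet (P Q : DJet d r) (m : ℕ) : DJet d r := fun k j => if m ≤ j then Q k j else P k j

lemma sum_eq_sum_Iio_add_sum_Ioi (f : Fin r → ℝ) (i : Fin r) :
    ∑ j, f j = ∑ j ∈ Iio i, f j + f i + ∑ j ∈ Ioi i, f j := by
  have h1 : (Finset.univ : Finset (Fin r)) = Iic i ∪ Ioi i := by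
    ext j
    simpa using le_or_gt j i
  have h2 : Disjoint (Iic i) (Ioi i) := Finset.disjoint_left.2 fun j hj hj' =>
    (mem_Ioi.1 hj').not_ge (mem_Iic.1 hj)
  rw [h1, Finset.sum_union h2, ← Finset.Iio_insert, Finset.sum_insert (by simp), add_comm (f i)]

lemma rowJet_mixedJet_succ (a : Matrix (Fin r) (Fin r) ℝ) (P Q : DJet d r) (i : Fin r)
    (k : Fin d) : rowJet a i (mixedJet P Q (i + 1)) k =
      ∑ j ∈ Iio i, a i j * P k j + a i i * P k i + ∑ j ∈ Ioi i, a i j * Q k j := by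
  rw [rowJet_of_lt, sum_eq_sum_Iio_add_sum_Ioi _ i]
  congr 1
  · congr 1
    · refine Finset.sum_congr rfl fun j hj => ?_
      have : j < i := mem_Iio.1 hj
      rw [mixedJet, if_neg (by omega)]
    · rw [mixedJet, if_neg (by omega)]
  · refine Finset.sum_congr rfl fun j hj => ?_
    have : i < j := mem_Ioi.1 hj
    rw [mixedJet, if_pos (by omega)]

/-- The exponent of the `i`-th equation has `u_n` below `i` and `u_{n+1}` above `i`, which is
exactly the state when the sweep reaches `i`. -/
lemma IsSemiDiscreteSolutionNear.mixedJet_eq_step {a : Matrix (Fin r) (Fin r) ℝ}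
    {u : ℤ → Fin r → ℝ → ℝ} {n : ℤ} {x₀ : ℝ} (hu : IsSemiDiscreteSolutionNear a d u n x₀)
    (i : Fin r) :
    mixedJet (derivJet d (u n) x₀) (derivJet d (u (n + 1)) x₀) i =
      step a i (deriv (u (n + 1) i) x₀ - deriv (u n i) x₀)
        (mixedJet (derivJet d (u n) x₀) (derivJet d (u (n + 1)) x₀) (i + 1)) := by
  obtain ⟨h0, h1, heq⟩ := hu
  set P := derivJet d (u n) x₀ with hP
  set Q := derivJet d (u (n + 1)) x₀ with hQ
  set g : ℝ → ℝ := fun x => deriv (u (n + 1) i) x - deriv (u n i) x with hg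
  set f : ℝ → ℝ := fun x => ∑ j ∈ Iio i, a i j * u n j x
      + a i i / 2 * (u n i x + u (n + 1) i x) + ∑ j ∈ Ioi i, a i j * u (n + 1) j x with hf
  have hgf : g =ᶠ[𝓝 x₀] fun x => Real.exp (f x) := heq.mono fun x hx => hx i
  have hfc : ∀ m : ℕ, m ≤ d → ContDiffAt ℝ m (fun x => ∑ j ∈ Iio i, a i j * u n j x) x₀ ∧
      ContDiffAt ℝ m (fun x => a i i / 2 * (u n i x + u (n + 1) i x)) x₀ ∧
      ContDiffAt ℝ m (fun x => ∑ j ∈ Ioi i, a i j * u (n + 1) j x) x₀ := by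
    intro m hm
    have hm' : (m : WithTop ℕ∞) ≤ d := by exact_mod_cast hm
    exact ⟨ContDiffAt.sum fun j _ => contDiffAt_const.mul ((h0 j).of_le hm'),
      contDiffAt_const.mul (((h0 i).of_le hm').add ((h1 i).of_le hm')),
      ContDiffAt.sum fun j _ => contDiffAt_const.mul ((h1 j).of_le hm')⟩
  have hgk : ∀ k : Fin d, iteratedDeriv k g x₀ = Q k i - P k i := by
    intro k
    have hk : ((k : ℕ) : WithTop ℕ∞) + 1 ≤ d := by exact_mod_cast k.2
    rw [hg, iteratedDeriv_fun_sub ((h1 i).derivWithin hk) ((h0 i).derivWithin hk),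
      ← iteratedDeriv_succ', ← iteratedDeriv_succ']
    rfl
  -- Since `u^i_{n,x} + u^i_{n+1,x} = 2 * u^i_{n,x} + g`, the diagonal term splits into `a_ii *
  -- u^i_{n,x}`, which completes the row, and `a_ii / 2 * g`.
  have hfk : ∀ k : Fin d, iteratedDeriv (k + 1) f x₀ =
      rowJet a i (mixedJet P Q (i + 1)) k + a i i / 2 * iteratedDeriv k g x₀ := by
    intro k
    have hk : (((k : ℕ) + 1 : ℕ) : WithTop ℕ∞) ≤ d := by exact_mod_cast k.2
    obtain ⟨c1, c2, c3⟩ := hfc (k + 1) k.2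
    rw [hf, iteratedDeriv_fun_add (c1.add c2) c3, iteratedDeriv_fun_add c1 c2,
      iteratedDeriv_fun_sum fun j _ => contDiffAt_const.mul ((h0 j).of_le hk),
      iteratedDeriv_fun_sum fun j _ => contDiffAt_const.mul ((h1 j).of_le hk),
      iteratedDeriv_const_mul_field,
      iteratedDeriv_fun_add ((h0 i).of_le hk) ((h1 i).of_le hk), hgk, rowJet_mixedJet_succ]
    simp only [iteratedDeriv_const_mul_field, hP, hQ, derivJet]
    ring
  have hfd : ContDiffAt ℝ d f x₀ := by
    obtain ⟨c1, c2, c3⟩ := hfc d le_rfl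
    exact (c1.add c2).add c3
  have hinc : ∀ k : Fin d, iteratedDeriv k g x₀ =
      increment (a i i) (rowJet a i (mixedJet P Q (i + 1))) (g x₀) k := by
    intro k
    refine eq_increment_of_recurrence (x := fun m => iteratedDeriv m g x₀) (n := k)
      (by simp only [iteratedDeriv_zero]) (fun m hm => ?_) k le_rfl
    rw [iteratedDeriv_exp_recurrence hfd hgf (hm.trans k.2)]
    refine Finset.sum_congr rfl fun q hq => ?_
    have hq' := mem_antidiagonal.1 hq
    have := hfk ⟨q.2, by have := k.2; omega⟩
    simp only at this
    rw [this]
  funext k j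
  simp only [step, mixedJet]
  rcases lt_trichotomy j i with h | h | h
  · have h' : (j : ℕ) < i := h
    rw [if_neg (by omega), if_neg h.ne, if_neg (by omega)]
  · subst h
    rw [if_pos le_rfl, if_pos rfl, if_neg (by omega), ← hinc, hgk]
    ring
  · have h' : (i : ℕ) < j := h
    rw [if_pos (by omega), if_neg h.ne', if_pos (by omega)]

/-- The mixed jet is `U_n` at threshold `r` and `U_{n+1}` at threshold `0`; each step lowers the
threshold by one. -/
lemma IsSemiDiscreteSolutionNear.sweep_eq {a : Matrix (Fin r) (Fin r) ℝ}
    {u : ℤ → Fin r → ℝ → ℝ} {n : ℤ} {x₀ : ℝ} (hu : IsSemiDiscreteSolutionNear a d u n x₀) :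
    sweep a (fun i => deriv (u (n + 1) i) x₀ - deriv (u n i) x₀) (derivJet d (u n) x₀) r =
      derivJet d (u (n + 1)) x₀ := by
  have h : ∀ m ≤ r,
      sweep a (fun i => deriv (u (n + 1) i) x₀ - deriv (u n i) x₀) (derivJet d (u n) x₀) m =
        mixedJet (derivJet d (u n) x₀) (derivJet d (u (n + 1)) x₀) (r - m) := by
    intro m
    induction m with
    | zero =>
      intro _
      funext k j
      simp [sweep, mixedJet]
    | succ m ih =>
      intro hm
      have hm' : m < r := hm
      have hs := hu.mixedJet_eq_step (Fin.rev ⟨m, hm'⟩)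
      have hv : ((Fin.rev ⟨m, hm'⟩ : Fin r) : ℕ) = r - (m + 1) := Fin.val_rev _
      rw [hv, show r - (m + 1) + 1 = r - m by omega] at hs
      rw [sweep, dif_pos hm', ih hm'.le, hs]
  rw [h r le_rfl]
  funext k j
  simp [mixedJet]

end ExpSystem

end

theorem mainTheorem1 (r d : ℕ) (a : Matrix (Fin r) (Fin r) ℝ) (ha : a.det ≠ 0)
    (Ω : Set (ExpSystem.DJet d r)) (hΩ : IsOpen Ω) (I : ExpSystem.DJet d r → ℝ)
    (hI : ExpSystem.IsYIntegralOn a Ω I) :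
    ExpSystem.IsNIntegralOn a Ω I ∧ (Ω = Set.univ → ExpSystem.IsNIntegral a I) := by
  refine ⟨fun P hP => ?_, ?_⟩
  · obtain ⟨ε, hε, hball⟩ := Metric.eventually_nhds_iff.1 (hI.eventually_sweep ha hΩ hP r)
    refine ⟨ε, hε, fun u n x₀ hu hP' hδ => ?_⟩
    subst hP'
    have hdist : dist (fun i => deriv (u (n + 1) i) x₀ - deriv (u n i) x₀) 0 < ε := by
      refine (dist_pi_lt_iff hε).2 fun i => ?_
      -- The increments are exponentials, so an upper bound already bounds their absolute values.
      have hpos : 0 < deriv (u (n + 1) i) x₀ - deriv (u n i) x₀ :=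
        hu.2.2.self_of_nhds i ▸ Real.exp_pos _
      rw [Pi.zero_apply, Real.dist_0_eq_abs, abs_of_pos hpos]
      exact hδ i
    have h := @hball (ExpSystem.derivJet d (u n) x₀,
      fun i => deriv (u (n + 1) i) x₀ - deriv (u n i) x₀)
      (by rw [Prod.dist_eq, dist_self]; exact max_lt hε hdist)
    rw [hu.sweep_eq] at h
    exact ⟨h.1, sub_eq_zero.2 h.2⟩
  · rintro rfl u n x₀ hu
    rw [← hu.sweep_eq, hI.apply_sweep_eq ha, sub_self]
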